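/- **Theorem 2 (Balancing Real Tables).** Let $g:\mathbb R^2\to\mathbb R$ be Lipschitz continuous with Lipschitz constant at most $\frac1{\sqrt2}$ (with respect to the Euclidean distance); the *ground* is the graph $z=g(x,y)$, and the *vertical distance* of a point $(x,y,z)$ from the ground is the signed number $z-g(x,y)$. A *real table* consists of a solid rectangle with diagonals of length $2$ (the top) and four legs, which are line segments of equal length $\ell>0$ attached to the four corners of the top, at right angles to it and all on the same side. The endpoints $A,B,C,D$ of the legs (the feet) are the vertices of a rectangle congruent to the top; they are labelled in cyclic order, counterclockwise as seen from the top, with either side $AB$ or $BC$ allowed to be the longer one. Let $O$ be the centre of $ABCD$ and let $r\in(0,1]$ be the length of the short side divided by the length of the long side. A position of the table in space, with $O$ on the $z$-axis, is called * *balanced locally* if all four feet are on the ground and no point of the table (top or legs) is below the ground; * an *equal hovering position at angle $\gamma$* if $A$ and $C$ are on the ground, $B$ and $D$ are at equal vertical distance from the ground, the table is not upside down (the normal vector of the rectangle $ABCD$ pointing towards the top has nonnegative $z$-component), and the projection of $\overrightarrow{OA}$ to the $xy$-plane is nonzero and makes the angle $\gamma$ with the positive $x$-axis. If $\ell\ge\frac{1}{\sqrt{1+r^2}}$,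 then the table can be balanced locally by turning it on the spot: for every $\gamma\in\mathbb R$ there is exactly one equal hovering position $T(\gamma)$ at angle $\gamma$; the position $T(\gamma)$ depends continuously on $\gamma$; and for every $\gamma_0\in\mathbb R$ there is a $\gamma\in[\gamma_0,\gamma_0+\pi]$ such that the table is balanced locally in the position $T(\gamma)$. -/

import Mathlib

open scoped Matrix

/-- The horizontal plane, with its Euclidean norm. -/
abbrev Plane := EuclideanSpace ℝ (Fin 2)

/-- Three-dimensional space; the coordinates `0, 1, 2` are `x, y, z`, and `z` is vertical. -/
abbrev Space := EuclideanSpace ℝ (Fin 3)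

/-- The signed vertical distance of a point from the ground `z = g (x, y)`: positive above the
ground, zero on it, negative below it. -/
def vertDist (g : Plane → ℝ) (p : Space) : ℝ :=
  p 2 - g !₂[p 0, p 1]

/-- The shape of a real table: a solid rectangular top with diagonals of length `2` and four legs
of equal length at its corners. The rectangle has vertices `A, B, C, D` in cyclic order, with
`AB = side₁` and `BC = side₂`; either of the two sides may be the longer one. -/
structure RealTable where
  side₁ : ℝ
  side₂ : ℝ
  leg : ℝ
  side₁_pos : 0 < side₁
  side₂_pos : 0 < side₂
  leg_pos : 0 < leg
  diagonal : side₁ ^ 2 + side₂ ^ 2 = 2 ^ 2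

namespace RealTable

noncomputable section

/-- The ratio of the short side to the long side. -/
def ratio (t : RealTable) : ℝ :=
  min t.side₁ t.side₂ / max t.side₁ t.side₂

/-! The table in its reference position: it stands on the plane `z = 0`, the centre of its feet is
the origin, and its sides are parallel to the axes. The feet `A, B, C, D` (the associated
mathematical table) are listed counterclockwise as seen from above. -/

def footA (t : RealTable) : Space := !₂[t.side₁ / 2, t.side₂ / 2, 0]

def footB (t : RealTable) : Space := !₂[-t.side₁ / 2, t.side₂ / 2, 0]

def footC (t : RealTable) : Space := !₂[-t.side₁ / 2, -t.side₂ / 2, 0]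

def footD (t : RealTable) : Space := !₂[t.side₁ / 2, -t.side₂ / 2, 0]

/-- The solid table top in the reference position. -/
def top (t : RealTable) : Set Space :=
  {p | |p 0| ≤ t.side₁ / 2 ∧ |p 1| ≤ t.side₂ / 2 ∧ p 2 = t.leg}

/-- The union of the four legs in the reference position. -/
def legs (t : RealTable) : Set Space :=
  {p | |p 0| = t.side₁ / 2 ∧ |p 1| = t.side₂ / 2 ∧ 0 ≤ p 2 ∧ p 2 ≤ t.leg}

/-- All points of the real table in the reference position. -/
def points (t : RealTable) : Set Space := t.top ∪ t.legs

end

end RealTable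

/-- A position of the table in space, that is, an orientation preserving rigid motion: the point to
which the origin (the centre of the feet) is moved, and a rotation. It carries the product
topology. -/
abbrev Position := Space × Matrix.specialOrthogonalGroup (Fin 3) ℝ

namespace Position

/-- Where a point of the reference position is moved to. -/
def move (P : Position) (p : Space) : Space :=
  P.1 + WithLp.toLp 2 ((P.2 : Matrix (Fin 3) (Fin 3) ℝ) *ᵥ (p : Fin 3 → ℝ))

/-- The centre of the feet lies on the `z`-axis. -/
def Centred (P : Position) : Prop := P.1 0 = 0 ∧ P.1 1 = 0

/-- The table is not upside down: the unit normal of the rectangle of feet that is directed towards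
the top has nonnegative `z`-component (zero if the rectangle of feet is vertical). -/
def Upright (P : Position) : Prop := 0 ≤ (P.2 : Matrix (Fin 3) (Fin 3) ℝ) 2 2

/-- The projection to the `xy`-plane of the vector from the centre to the foot `A` is nonzero and
makes the angle `γ` with the positive `x`-axis. -/
def HasAngle (P : Position) (t : RealTable) (γ : ℝ) : Prop :=
  ∃ ρ : ℝ, 0 < ρ ∧ P.move t.footA 0 - P.1 0 = ρ * Real.cos γ ∧
    P.move t.footA 1 - P.1 1 = ρ * Real.sin γ

/-- An equal hovering position: the centre is on the `z`-axis, the opposite feet `A` and `C` touch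
the ground, and the feet `B` and `D` are at equal signed vertical distance from the ground. -/
def EqualHovering (P : Position) (t : RealTable) (g : Plane → ℝ) : Prop :=
  P.Centred ∧ P.Upright ∧
    vertDist g (P.move t.footA) = 0 ∧ vertDist g (P.move t.footC) = 0 ∧
    vertDist g (P.move t.footB) = vertDist g (P.move t.footD)

/-- The real table is balanced locally: the centre is on the `z`-axis, all four feet are on the
ground, and no point of the table is below the ground. -/
def BalancedLocally (P : Position) (t : RealTable) (g : Plane → ℝ) : Prop :=
  P.Centred ∧
    vertDist g (P.move t.footA) = 0 ∧ vertDist g (P.move t.footB) = 0 ∧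
    vertDist g (P.move t.footC) = 0 ∧ vertDist g (P.move t.footD) = 0 ∧
    ∀ p ∈ t.points, 0 ≤ vertDist g (P.move p)

end Position

/-- The table can be balanced locally by turning it on the spot: for every angle `γ` there is exactly
one equal hovering position `T γ` in which `A` points in the direction `γ`, this position depends
continuously on `γ`, and, from whichever angle one starts, the table is balanced locally at some
moment of a half-turn through these positions. -/
def CanBeBalancedByTurning (t : RealTable) (g : Plane → ℝ) : Prop :=
  ∃ T : ℝ → Position, Continuous T ∧
    (∀ (γ : ℝ) (P : Position), P.EqualHovering t g ∧ P.HasAngle t γ ↔ P = T γ) ∧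
    ∀ γ₀ : ℝ, ∃ γ ∈ Set.Icc γ₀ (γ₀ + Real.pi), (T γ).BalancedLocally t g

/-! Let the centre of the feet be at height h on the axis, and let ±u, ±v be the vectors from it to
A, C and B, D. Split the ground g into its odd part d and its even part E under (x, y) ↦ (-x, -y).
Then A and C are on the ground iff u lies on the graph of d and h = E(u), while B and D hover
equally iff v lies on the graph of d. Equal hovering is thus a problem about d alone, and h is read
off afterwards.

Slope at most 1/√2 leaves exactly one point of the graph on each meridian of the unit sphere
(`exists_pitch`); this fixes u. Given u, the vector v runs through a half circle whose ends, in the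
vertical plane of u, lie above and below the graph. At a solution both sides of the rectangle are
parallel to chords of the graph, hence flat, so the normal has vertical component N with 3N² ≥ 1;
this makes the solution unique (`exists_roll`). Uniqueness and compactness give continuity.

Let H(γ) = E(u) be the height of the centre. It has period π, because d is odd and E is even. As v
is also a unit vector on the graph, E(v) is always some value of H. So H - E(v) is ≤ 0 at a minimum
of H and ≥ 0 at a maximum, and vanishes in between; there B and D touch the ground as well.

A point displaced upward from a grounded foot by a vector with 3z² ≥ |·|² is not below the ground.
The legs are such vectors. For the top, a weighted mean of 3z² - |·|² over the vectors from the four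
feet is nonnegative once the legs reach half the longer side, and none of these vectors is steep
downward (`exists_foot_steeply_below`). -/

/-- A continuous family of functions on `[-1, 1]`, each with a sign change and at most one zero,
has a zero that depends continuously on the parameter. -/
theorem exists_continuous_unique_zero {X : Type*} [TopologicalSpace X] (f : X → ℝ → ℝ)
    (hf : Continuous fun z : X × ℝ => f z.1 z.2)
    (hneg : ∀ γ, f γ (-1) ≤ 0) (hpos : ∀ γ, 0 ≤ f γ 1)
    (huniq : ∀ γ, ∀ x ∈ Set.Icc (-1 : ℝ) 1, ∀ y ∈ Set.Icc (-1 : ℝ) 1,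
      f γ x = 0 → f γ y = 0 → x = y) :
    ∃ φ : X → ℝ, Continuous φ ∧ ∀ γ x, (x ∈ Set.Icc (-1 : ℝ) 1 ∧ f γ x = 0) ↔ x = φ γ := by
  have hex : ∀ γ, ∃ x : Set.Icc (-1 : ℝ) 1, f γ x = 0 := by
    intro γ
    have hc : ContinuousOn (f γ) (Set.Icc (-1) 1) :=
      (hf.comp (continuous_const.prodMk continuous_id)).continuousOn
    obtain ⟨x, hx, hx0⟩ := intermediate_value_Icc (by norm_num : (-1 : ℝ) ≤ 1) hc
      ⟨hneg γ, hpos γ⟩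
    exact ⟨⟨x, hx⟩, hx0⟩
  choose φ hφ using hex
  refine ⟨fun γ => φ γ, ?_, fun γ x => ⟨fun h => huniq γ x h.1 _ (φ γ).2 h.2 (hφ γ), ?_⟩⟩
  -- The preimage of a closed set is the projection of a closed set of zeros along a compact factor,
  -- hence closed.
  · refine continuous_subtype_val.comp (continuous_iff_isClosed.2 fun C hC => ?_)
    have hcl : IsClosed {z : X × Set.Icc (-1 : ℝ) 1 | f z.1 z.2 = 0 ∧ z.2 ∈ C} :=
      (isClosed_eq (hf.comp (continuous_fst.prodMk (continuous_subtype_val.comp continuous_snd)))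
        continuous_const).inter (hC.preimage continuous_snd)
    convert isClosedMap_fst_of_compactSpace _ hcl using 1
    ext γ
    constructor
    · intro h
      exact ⟨(γ, φ γ), ⟨hφ γ, h⟩, rfl⟩
    · rintro ⟨⟨γ', x⟩, ⟨h0, hx⟩, rfl⟩
      have : x = φ γ' := Subtype.ext (huniq γ' x x.2 _ (φ γ').2 h0 (hφ γ'))
      exact this ▸ hx
  · rintro rfl
    exact ⟨(φ γ).2, hφ γ⟩

/-! ### Graphs of odd Lipschitz functions and the unit sphere -/

/-- A function of two real variables is odd, and Lipschitz with constant `1 / √2`. -/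
structure OddLipschitz (d : ℝ → ℝ → ℝ) : Prop where
  odd : ∀ x y, d (-x) (-y) = -d x y
  lip : ∀ x y x' y', 2 * (d x y - d x' y') ^ 2 ≤ (x - x') ^ 2 + (y - y') ^ 2

namespace OddLipschitz

variable {d : ℝ → ℝ → ℝ}

theorem neg (hd : OddLipschitz d) : OddLipschitz fun x y => -d x y where
  odd x y := by rw [hd.odd]
  lip x y x' y' := by linarith [hd.lip x y x' y', sq_abs (d x y - d x' y'),
    show (-d x y - -d x' y') ^ 2 = (d x y - d x' y') ^ 2 by ring]

theorem zero (hd : OddLipschitz d) : d 0 0 = 0 := by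
  have := hd.odd 0 0
  simp only [neg_zero] at this
  linarith

theorem continuous (hd : OddLipschitz d) : Continuous fun z : ℝ × ℝ => d z.1 z.2 := by
  have : LipschitzWith 1 fun z : ℝ × ℝ => d z.1 z.2 := by
    refine LipschitzWith.of_dist_le_mul fun z w => ?_
    have h := hd.lip z.1 z.2 w.1 w.2
    have h1 : |z.1 - w.1| ≤ dist z w := le_max_left _ _
    have h2 : |z.2 - w.2| ≤ dist z w := le_max_right _ _
    rw [NNReal.coe_one, one_mul, Real.dist_eq]
    refine abs_le_of_sq_le_sq ?_ dist_nonneg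
    nlinarith [sq_le_sq' (neg_le_of_abs_le h1) (le_of_abs_le h1),
      sq_le_sq' (neg_le_of_abs_le h2) (le_of_abs_le h2)]
  exact this.continuous

theorem comp (hd : OddLipschitz d) {X : Type*} [TopologicalSpace X] {f g : X → ℝ}
    (hf : Continuous f) (hg : Continuous g) : Continuous fun x => d (f x) (g x) :=
  hd.continuous.comp (hf.prodMk hg)

/-- The part of the graph of `d` on the unit sphere is not steep. -/
theorem sq_le (hd : OddLipschitz d) {x y z : ℝ} (h : z = d x y) : 2 * z ^ 2 ≤ x ^ 2 + y ^ 2 := by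
  have := hd.lip x y 0 0
  rw [hd.zero, ← h] at this
  simpa using this

/-- On each meridian of the unit sphere there is only one point of the graph of `d`. -/
theorem meridian_unique (hd : OddLipschitz d) {e₀ e₁ c c' s s' : ℝ} (he : e₀ ^ 2 + e₁ ^ 2 = 1)
    (hc : 0 ≤ c) (hc' : 0 ≤ c') (hs : c ^ 2 + s ^ 2 = 1) (hs' : c' ^ 2 + s' ^ 2 = 1)
    (h : s = d (c * e₀) (c * e₁)) (h' : s' = d (c' * e₀) (c' * e₁)) : s = s' := by
  have h1 : 2 * s ^ 2 ≤ c ^ 2 := by linear_combination hd.sq_le h + c ^ 2 * he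
  have h1' : 2 * s' ^ 2 ≤ c' ^ 2 := by linear_combination hd.sq_le h' + c' ^ 2 * he
  have h2 : 2 * (s - s') ^ 2 ≤ (c - c') ^ 2 := by
    have := hd.lip (c * e₀) (c * e₁) (c' * e₀) (c' * e₁)
    rw [← h, ← h'] at this
    linear_combination this + (c - c') ^ 2 * he
  have hcpos : 0 < c + c' := by nlinarith
  have h3 : (s + s') ^ 2 ≤ (c + c') ^ 2 := by
    nlinarith [mul_nonneg hc hc', sq_nonneg (s - s')]
  -- A chord of the circle is orthogonal to the sum of its endpoints. That sum is flat, so a nonzero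
  -- chord would be steeper than the graph allows.
  have h4 : (c - c') ^ 2 * (c + c') ^ 2 = (s - s') ^ 2 * (s + s') ^ 2 := by
    have : (c - c') * (c + c') = -((s - s') * (s + s')) := by linear_combination hs - hs'
    rw [← mul_pow, this]; ring
  have h5 : (s - s') ^ 2 * (c + c') ^ 2 ≤ 0 := by
    nlinarith [mul_le_mul_of_nonneg_left h3 (sq_nonneg (s - s')),
      mul_le_mul_of_nonneg_right h2 (sq_nonneg (c + c'))]
  have h6 : (s - s') ^ 2 ≤ 0 := by
    by_contra hcon
    push Not at hcon
    have := mul_pos hcon (pow_pos hcpos 2)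
    linarith
  have := pow_eq_zero_iff (two_ne_zero) |>.1 (le_antisymm h6 (sq_nonneg _))
  linarith

/-- A point of a meridian circle that is reached from a point on the graph of `d` by an upward
rotation through an angle strictly between `0` and `π` lies above the graph. The half of this angle
has cosine `q` and sine `p`. -/
theorem lt_of_rotate_up (hd : OddLipschitz d) {e₀ e₁ c s p q : ℝ} (he : e₀ ^ 2 + e₁ ^ 2 = 1)
    (hc : 0 < c) (h : s = d (c * e₀) (c * e₁)) (hp : 0 < p) (hq : 0 < q) (hpq : p ^ 2 + q ^ 2 = 1) :
    d (((q ^ 2 - p ^ 2) * c - 2 * p * q * s) * e₀) (((q ^ 2 - p ^ 2) * c - 2 * p * q * s) * e₁) <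
      (q ^ 2 - p ^ 2) * s + 2 * p * q * c := by
  by_contra hcon
  push Not at hcon
  set X := (q ^ 2 - p ^ 2) * c - 2 * p * q * s with hX
  set δ := d (X * e₀) (X * e₁) with hδ
  have h1 : 2 * s ^ 2 ≤ c ^ 2 := by linear_combination hd.sq_le h + c ^ 2 * he
  have h2 : 2 * (δ - s) ^ 2 ≤ (X - c) ^ 2 := by
    have := hd.lip (X * e₀) (X * e₁) (c * e₀) (c * e₁)
    rw [← h, ← hδ] at this
    linear_combination this + (X - c) ^ 2 * he
  -- By oddness the antipode of the starting point is on the graph too and gives a second Lipschitz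
  -- bound.
  have h3 : 2 * (δ + s) ^ 2 ≤ (X + c) ^ 2 := by
    have := hd.lip (X * e₀) (X * e₁) (-(c * e₀)) (-(c * e₁))
    rw [hd.odd, ← h, ← hδ] at this
    linear_combination this + (X + c) ^ 2 * he
  -- (m, l) is the starting point rotated through half the angle: end minus start is 2p(-l, m), end
  -- plus start is 2q(m, l).
  set m := q * c - p * s with hm
  set l := q * s + p * c with hl
  have hcm : c = q * m + p * l := by rw [hm, hl]; linear_combination -c * hpq
  have hsm : s = q * l - p * m := by rw [hm, hl]; linear_combination -s * hpq
  have hXc : X - c = -(2 * p * l) := by rw [hX, hl]; linear_combination c * hpq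
  have hXc' : X + c = 2 * q * m := by rw [hX, hm]; linear_combination -c * hpq
  have e1 : 2 * p * m ≤ δ - s := by
    rw [hm]; linear_combination hcon - s * hpq
  have e2 : 2 * q * l ≤ δ + s := by
    rw [hl]; linear_combination hcon + s * hpq
  rw [hXc] at h2
  rw [hXc'] at h3
  have a1 : 0 < m → 2 * m ^ 2 ≤ l ^ 2 := by
    intro hm0
    have : (2 * p * m) ^ 2 ≤ (δ - s) ^ 2 := pow_le_pow_left₀ (by positivity) e1 2
    have : 0 ≤ (4 * p ^ 2) * (l ^ 2 - 2 * m ^ 2) := by linarith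
    have := nonneg_of_mul_nonneg_right this (by positivity)
    linarith
  have a2 : 0 < l → 2 * l ^ 2 ≤ m ^ 2 := by
    intro hl0
    have : (2 * q * l) ^ 2 ≤ (δ + s) ^ 2 := pow_le_pow_left₀ (by positivity) e2 2
    have : 0 ≤ (4 * q ^ 2) * (m ^ 2 - 2 * l ^ 2) := by linarith
    have := nonneg_of_mul_nonneg_right this (by positivity)
    linarith
  have hsc : |s| < c := abs_lt_of_sq_lt_sq (by nlinarith) hc.le
  obtain ⟨hs1, hs2⟩ := abs_lt.1 hsc
  rcases lt_or_ge 0 m with hm0 | hm0 <;> rcases lt_or_ge 0 l with hl0 | hl0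
  · nlinarith [a1 hm0, a2 hl0, pow_pos hm0 2, pow_pos hl0 2]
  · have h5 : m ≤ -l := by nlinarith [a1 hm0]
    linarith [mul_le_mul_of_nonneg_left h5 hq.le, mul_pos hp hm0,
      mul_nonneg hp.le (neg_nonneg.2 hl0)]
  · have h5 : l ≤ -m := by nlinarith [a2 hl0]
    linarith [mul_le_mul_of_nonneg_left h5 hp.le, mul_pos hq hl0,
      mul_nonneg hq.le (neg_nonneg.2 hm0)]
  · linarith [mul_nonneg hq.le (neg_nonneg.2 hm0), mul_nonneg hp.le (neg_nonneg.2 hl0)]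

/-- Reflection in the horizontal plane turns d into -d and upward rotations into downward ones. -/
theorem lt_of_rotate_down (hd : OddLipschitz d) {e₀ e₁ c s p q : ℝ} (he : e₀ ^ 2 + e₁ ^ 2 = 1)
    (hc : 0 < c) (h : s = d (c * e₀) (c * e₁)) (hp : 0 < p) (hq : 0 < q) (hpq : p ^ 2 + q ^ 2 = 1) :
    (q ^ 2 - p ^ 2) * s - 2 * p * q * c <
    d (((q ^ 2 - p ^ 2) * c + 2 * p * q * s) * e₀) (((q ^ 2 - p ^ 2) * c + 2 * p * q * s) * e₁) := by
  have := hd.neg.lt_of_rotate_up (s := -s) he hc (by rw [← h]) hp hq hpq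
  simp only [mul_neg, sub_neg_eq_add] at this
  linarith

/-! ### Flat sides and uniqueness of the roll -/

/-- If `±u` and `±v`, where `u = p a + q b` and `v = - p a + q b`, are on the graph of `d`, then
the side `a` of the rectangle is not steep. -/
theorem side_flat (hd : OddLipschitz d) {p : ℝ} (hp : 0 < p) {a₀ a₁ a₂ b₀ b₁ b₂ : ℝ}
    (hu : p * a₂ + b₂ = d (p * a₀ + b₀) (p * a₁ + b₁))
    (hv : -p * a₂ + b₂ = d (-p * a₀ + b₀) (-p * a₁ + b₁)) :
    2 * a₂ ^ 2 ≤ a₀ ^ 2 + a₁ ^ 2 := by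
  have := hd.lip (p * a₀ + b₀) (p * a₁ + b₁) (-p * a₀ + b₀) (-p * a₁ + b₁)
  rw [← hu, ← hv] at this
  have : 0 ≤ (4 * p ^ 2) * (a₀ ^ 2 + a₁ ^ 2 - 2 * a₂ ^ 2) := by linarith
  have := nonneg_of_mul_nonneg_right this (by positivity)
  linarith

/-- The side `b`: replace `v` by `-v`. -/
theorem side_flat_right (hd : OddLipschitz d) {q : ℝ} (hq : 0 < q) {a₀ a₁ a₂ b₀ b₁ b₂ : ℝ}
    (hu : a₂ + q * b₂ = d (a₀ + q * b₀) (a₁ + q * b₁))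
    (hv : -a₂ + q * b₂ = d (-a₀ + q * b₀) (-a₁ + q * b₁)) :
    2 * b₂ ^ 2 ≤ b₀ ^ 2 + b₁ ^ 2 := by
  refine hd.side_flat hq (b₀ := a₀) (b₁ := a₁) (b₂ := a₂) ?_ ?_
  · rw [add_comm, hu, add_comm a₀, add_comm a₁]
  · rw [show -q * b₂ + a₂ = -(-a₂ + q * b₂) by ring, hv, ← hd.odd]
    congr 1 <;> ring

end OddLipschitz

namespace OddLipschitz

variable {d : ℝ → ℝ → ℝ}

/-- Let `u = c e + s z` be a unit vector with horizontal part along the unit vector `e`, and let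
`w` be the unit vector orthogonal to `u` with the coordinates `C`, `S` in the frame of `e^⊥` and
`- s e + c z`. If `u` and `(q² - p²) u + 2 p q w` are on the graph of `d`, then the normal `u × w`
makes a large angle with the horizontal plane. -/
theorem one_le_normal_sq (hd : OddLipschitz d) {e₀ e₁ c s C S p q : ℝ} (he : e₀ ^ 2 + e₁ ^ 2 = 1)
    (hcs : c ^ 2 + s ^ 2 = 1) (hCS : C ^ 2 + S ^ 2 = 1) (hp : 0 < p) (hq : 0 < q)
    (hpq : p ^ 2 + q ^ 2 = 1) (hu : s = d (c * e₀) (c * e₁))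
    (hv : (q ^ 2 - p ^ 2) * s + 2 * p * q * (S * c) =
      d ((q ^ 2 - p ^ 2) * (c * e₀) + 2 * p * q * (-C * e₁ - S * s * e₀))
        ((q ^ 2 - p ^ 2) * (c * e₁) + 2 * p * q * (C * e₀ - S * s * e₁))) :
    1 ≤ 3 * (c * C) ^ 2 := by
  -- The unit side directions are a = p u - q w and b = q u + p w, so that u = p a + q b and the
  -- second diagonal is -p a + q b.
  have key : ∀ x y : ℝ, p * (p * x - q * y) + q * (q * x + p * y) = x ∧
      -p * (p * x - q * y) + q * (q * x + p * y) = (q ^ 2 - p ^ 2) * x + 2 * p * q * y :=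
    fun x y => ⟨by linear_combination x * hpq, by ring⟩
  have hu' := hu
  rw [← (key s (S * c)).1, ← (key (c * e₀) (-C * e₁ - S * s * e₀)).1,
    ← (key (c * e₁) (C * e₀ - S * s * e₁)).1] at hu'
  have hv' := hv
  rw [← (key s (S * c)).2, ← (key (c * e₀) (-C * e₁ - S * s * e₀)).2,
    ← (key (c * e₁) (C * e₀ - S * s * e₁)).2] at hv'
  have ha := hd.side_flat hp hu' hv'
  simp only [neg_mul p] at hv'
  have hb := hd.side_flat_right hq hu' hv'
  have h1 : (p * (c * e₀) - q * (-C * e₁ - S * s * e₀)) ^ 2 +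
      (p * (c * e₁) - q * (C * e₀ - S * s * e₁)) ^ 2 + (p * s - q * (S * c)) ^ 2 = 1 := by
    linear_combination (p ^ 2 * c ^ 2 + q ^ 2 * (C ^ 2 + S ^ 2 * s ^ 2) + 2 * p * q * c * S * s) * he
      + (p ^ 2 + q ^ 2 * S ^ 2) * hcs + q ^ 2 * hCS + hpq
  have h2 : (q * (c * e₀) + p * (-C * e₁ - S * s * e₀)) ^ 2 +
      (q * (c * e₁) + p * (C * e₀ - S * s * e₁)) ^ 2 + (q * s + p * (S * c)) ^ 2 = 1 := by
    linear_combination (q ^ 2 * c ^ 2 + p ^ 2 * (C ^ 2 + S ^ 2 * s ^ 2) - 2 * p * q * c * S * s) * he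
      + (q ^ 2 + p ^ 2 * S ^ 2) * hcs + p ^ 2 * hCS + hpq
  -- The vertical components of a, b and the normal have squares summing to 1, and the first two
  -- squares are at most 1/3.
  have h3 : (p * s - q * (S * c)) ^ 2 + (q * s + p * (S * c)) ^ 2 + (c * C) ^ 2 = 1 := by
    linear_combination (s ^ 2 + S ^ 2 * c ^ 2) * hpq + c ^ 2 * hCS + hcs
  linarith

/-- For a given `u` there is at most one `w` as in `one_le_normal_sq`. -/
theorem roll_unique (hd : OddLipschitz d) {e₀ e₁ c s C S C' S' p q : ℝ}
    (he : e₀ ^ 2 + e₁ ^ 2 = 1) (hcs : c ^ 2 + s ^ 2 = 1) (hc : 0 < c)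
    (hCS : C ^ 2 + S ^ 2 = 1) (hC : 0 ≤ C) (hCS' : C' ^ 2 + S' ^ 2 = 1) (hC' : 0 ≤ C')
    (hp : 0 < p) (hq : 0 < q) (hpq : p ^ 2 + q ^ 2 = 1) (hu : s = d (c * e₀) (c * e₁))
    (hv : (q ^ 2 - p ^ 2) * s + 2 * p * q * (S * c) =
      d ((q ^ 2 - p ^ 2) * (c * e₀) + 2 * p * q * (-C * e₁ - S * s * e₀))
        ((q ^ 2 - p ^ 2) * (c * e₁) + 2 * p * q * (C * e₀ - S * s * e₁)))
    (hv' : (q ^ 2 - p ^ 2) * s + 2 * p * q * (S' * c) =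
      d ((q ^ 2 - p ^ 2) * (c * e₀) + 2 * p * q * (-C' * e₁ - S' * s * e₀))
        ((q ^ 2 - p ^ 2) * (c * e₁) + 2 * p * q * (C' * e₀ - S' * s * e₁))) :
    S = S' := by
  have h1 := hd.one_le_normal_sq he hcs hCS hp hq hpq hu hv
  have h1' := hd.one_le_normal_sq he hcs hCS' hp hq hpq hu hv'
  have h2 := hd.lip ((q ^ 2 - p ^ 2) * (c * e₀) + 2 * p * q * (-C * e₁ - S * s * e₀))
    ((q ^ 2 - p ^ 2) * (c * e₁) + 2 * p * q * (C * e₀ - S * s * e₁))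
    ((q ^ 2 - p ^ 2) * (c * e₀) + 2 * p * q * (-C' * e₁ - S' * s * e₀))
    ((q ^ 2 - p ^ 2) * (c * e₁) + 2 * p * q * (C' * e₀ - S' * s * e₁))
  rw [← hv, ← hv'] at h2
  have h3 : 0 ≤ (4 * (p * q) ^ 2) *
      ((C - C') ^ 2 + (S - S') ^ 2 - 3 * (S - S') ^ 2 * c ^ 2) := by
    linear_combination h2 + 4 * (p * q) ^ 2 * ((C - C') ^ 2 + (S - S') ^ 2 * s ^ 2) * he
      + 4 * (p * q) ^ 2 * (S - S') ^ 2 * hcs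
  have h4 := nonneg_of_mul_nonneg_right h3 (by positivity)
  by_contra hne
  have hS : 0 < (S - S') ^ 2 := by
    have := sub_ne_zero.2 hne
    positivity
  have h5 : (C - C') ^ 2 * (C + C') ^ 2 = (S - S') ^ 2 * (S + S') ^ 2 := by
    have : (C - C') * (C + C') = -((S - S') * (S + S')) := by linear_combination hCS - hCS'
    rw [← mul_pow, this]; ring
  have h6 : 0 ≤ (S - S') ^ 2 * ((S + S') ^ 2 + (C + C') ^ 2 - 3 * c ^ 2 * (C + C') ^ 2) := by
    linear_combination mul_nonneg h4 (sq_nonneg (C + C')) + h5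
  have h7 := nonneg_of_mul_nonneg_right h6 hS
  -- With `h1` and `h1'` this gives 3c²(C + C')² ≥ 4, so by `h7` the sum of the unit vectors (C, S),
  -- (C', S') has length at least 2, which forces them to coincide.
  have h8 : (2 : ℝ) ≤ 6 * ((c * C) * (c * C')) := by
    have hx : 0 ≤ c * C := by positivity
    have hy : 0 ≤ c * C' := by positivity
    have : (1 / 3 : ℝ) ^ 2 ≤ ((c * C) * (c * C')) ^ 2 := by
      rw [mul_pow]; nlinarith only [h1, h1']
    have := (sq_le_sq₀ (by norm_num) (by positivity)).1 this
    linarith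
  linarith [sq_nonneg (C - C')]

end OddLipschitz

/-! ### Steepness of the vectors from the feet to the table top -/

/-- A vector in the rectangle with sides `2 p`, `2 q` in the directions `a`, `b` with the vertical
components `A`, `B`, raised by `l` along the normal, is never steeply downward. -/
theorem not_steep_down {A B N p q l y₁ y₂ : ℝ} (hABN : A ^ 2 + B ^ 2 + N ^ 2 = 1)
    (hN0 : 0 < N) (hN : 1 ≤ 3 * N ^ 2)
    (hl0 : 0 < l) (hl : 1 ≤ 2 * l ^ 2) (hU : 3 * (p * A + q * B) ^ 2 ≤ 1)
    (hV : 3 * (-p * A + q * B) ^ 2 ≤ 1) (hy₁ : |y₁| ≤ 2 * p) (hy₂ : |y₂| ≤ 2 * q)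
    (hneg : y₁ * A + y₂ * B + l * N < 0) :
    3 * (y₁ * A + y₂ * B + l * N) ^ 2 < y₁ ^ 2 + y₂ ^ 2 + l ^ 2 := by
  by_contra! hcon
  obtain ⟨Y, hY⟩ : ∃ Y, Y = -(y₁ * A + y₂ * B) := ⟨_, rfl⟩
  have hlN : 0 < l * N := mul_pos hl0 hN0
  have hYl : l * N < Y := by linarith
  -- The extreme value is attained along a full diagonal, twice a half diagonal with squared height
  -- at most 1/3.
  have hYle : 3 * Y ^ 2 ≤ 4 := by
    have h1 : |Y| ≤ 2 * (p * |A| + q * |B|) := by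
      rw [hY, abs_neg]
      refine (abs_add_le _ _).trans ?_
      rw [abs_mul, abs_mul]
      linarith [mul_le_mul_of_nonneg_right hy₁ (abs_nonneg A),
        mul_le_mul_of_nonneg_right hy₂ (abs_nonneg B)]
    have h2 : 3 * (p * |A| + q * |B|) ^ 2 ≤ 1 := by
      rcases abs_cases A with ⟨hA, -⟩ | ⟨hA, -⟩ <;> rcases abs_cases B with ⟨hB, -⟩ | ⟨hB, -⟩ <;>
        rw [hA, hB] <;> linarith
    have h3 := pow_le_pow_left₀ (abs_nonneg Y) h1 2
    rw [sq_abs] at h3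
    linarith
  have hCauchy : 3 * Y ^ 2 ≤ 2 * (y₁ ^ 2 + y₂ ^ 2) := by
    have h1 : Y ^ 2 ≤ (y₁ ^ 2 + y₂ ^ 2) * (A ^ 2 + B ^ 2) := by
      rw [hY]; linarith [sq_nonneg (y₁ * B - y₂ * A)]
    have h2 : 3 * (A ^ 2 + B ^ 2) ≤ 2 := by linarith
    have h3 := mul_le_mul_of_nonneg_left h2 (add_nonneg (sq_nonneg y₁) (sq_nonneg y₂))
    linarith
  rw [show y₁ * A + y₂ * B + l * N = -(Y - l * N) by rw [hY]; ring] at hcon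
  obtain ⟨m, hm⟩ : ∃ m, m = l * N := ⟨_, rfl⟩
  rw [← hm] at hlN hYl hcon
  have hm2 : 1 ≤ 6 * m ^ 2 := by
    rw [hm, mul_pow]
    nlinarith [mul_nonneg (sub_nonneg.2 hl) (sub_nonneg.2 hN)]
  have hY0 : 0 < Y := hlN.trans hYl
  -- The bounds combine to 3Y² - 12mY + 6m² ≥ 1. This fails for m < Y ≤ 3m, and for Y > 3m it
  -- contradicts 3Y² ≤ 4 and 6m² ≥ 1.
  have k1 : 2 * m < Y := by
    by_contra! h
    nlinarith [mul_pos hlN (sub_pos.2 hYl), mul_nonneg hY0.le (sub_nonneg.2 h)]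
  have k2 : 3 * m < Y := by
    by_contra! h
    nlinarith [mul_pos hlN (sub_pos.2 k1), mul_nonneg hY0.le (sub_nonneg.2 h)]
  nlinarith [mul_pos hlN (sub_pos.2 k1), mul_pos hlN (sub_pos.2 k2)]

/-- The weights are nonnegative and not both zero. Nesting two such means gives the bilinear weights
of a point in the rectangle with respect to its corners. -/
theorem weighted_neg {p x Q R : ℝ} (hp : 0 < p) (hx : |x| ≤ p) (hQ : Q < 0) (hR : R < 0) :
    (p + x) * Q + (p - x) * R < 0 := by
  obtain ⟨h1, h2⟩ := abs_le.1 hx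
  rcases le_total 0 x with h | h <;> nlinarith

/-- Every point of the table top is above one of the feet, and steeply so. -/
theorem exists_foot_steeply_below {A B N p q l x₁ x₂ : ℝ} (hABN : A ^ 2 + B ^ 2 + N ^ 2 = 1)
    (hN0 : 0 < N) (hA : 3 * A ^ 2 ≤ 1) (hB : 3 * B ^ 2 ≤ 1) (hp : 0 < p) (hq : 0 < q)
    (hpq : p ^ 2 + q ^ 2 = 1) (hpl : p ≤ l) (hql : q ≤ l) (hU : 3 * (p * A + q * B) ^ 2 ≤ 1)
    (hV : 3 * (-p * A + q * B) ^ 2 ≤ 1) (hx₁ : |x₁| ≤ p) (hx₂ : |x₂| ≤ q) :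
    ∃ f₁ f₂ : ℝ, (f₁ = p ∨ f₁ = -p) ∧ (f₂ = q ∨ f₂ = -q) ∧
      0 ≤ (x₁ - f₁) * A + (x₂ - f₂) * B + l * N ∧
      (x₁ - f₁) ^ 2 + (x₂ - f₂) ^ 2 + l ^ 2 ≤
        3 * ((x₁ - f₁) * A + (x₂ - f₂) * B + l * N) ^ 2 := by
  by_contra! hcon
  have hl0 : 0 < l := hp.trans_le hpl
  have hl2 : 1 ≤ 2 * l ^ 2 := by
    linarith [pow_le_pow_left₀ hp.le hpl 2, pow_le_pow_left₀ hq.le hql 2]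
  have key : ∀ f₁ f₂ : ℝ, (f₁ = p ∨ f₁ = -p) → (f₂ = q ∨ f₂ = -q) →
      3 * ((x₁ - f₁) * A + (x₂ - f₂) * B + l * N) ^ 2 -
        ((x₁ - f₁) ^ 2 + (x₂ - f₂) ^ 2 + l ^ 2) < 0 := by
    intro f₁ f₂ h₁ h₂
    rw [sub_neg]
    rcases le_or_gt 0 ((x₁ - f₁) * A + (x₂ - f₂) * B + l * N) with h | h
    · exact hcon f₁ f₂ h₁ h₂ h
    · refine not_steep_down hABN hN0 (by linarith) hl0 hl2 hU hV ?_ ?_ h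
      · obtain ⟨h3, h4⟩ := abs_le.1 hx₁
        rcases h₁ with rfl | rfl <;> exact abs_le.2 ⟨by linarith, by linarith⟩
      · obtain ⟨h3, h4⟩ := abs_le.1 hx₂
        rcases h₂ with rfl | rfl <;> exact abs_le.2 ⟨by linarith, by linarith⟩
  -- These weights make the mean displacement from the feet vanish in both side directions, so the
  -- mixed terms of the quadratic form cancel.
  have hsum := weighted_neg hq hx₂
    (weighted_neg hp hx₁ (key p q (.inl rfl) (.inl rfl)) (key (-p) q (.inr rfl) (.inl rfl)))
    (weighted_neg hp hx₁ (key p (-q) (.inl rfl) (.inr rfl)) (key (-p) (-q) (.inr rfl) (.inr rfl)))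
  have hneg : 4 * (p * q) * (l ^ 2 * (3 * N ^ 2 - 1) + (3 * A ^ 2 - 1) * (p ^ 2 - x₁ ^ 2) +
      (3 * B ^ 2 - 1) * (q ^ 2 - x₂ ^ 2)) < 0 := by
    linarith
  have hx₁2 : p ^ 2 - x₁ ^ 2 ≤ l ^ 2 := by
    linarith [pow_le_pow_left₀ hp.le hpl 2, sq_nonneg x₁]
  have hx₂2 : q ^ 2 - x₂ ^ 2 ≤ l ^ 2 := by
    linarith [pow_le_pow_left₀ hq.le hql 2, sq_nonneg x₂]
  have h1 := mul_le_mul_of_nonneg_left hx₁2 (sub_nonneg.2 hA)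
  have h2 := mul_le_mul_of_nonneg_left hx₂2 (sub_nonneg.2 hB)
  have h3 : 0 ≤ l ^ 2 * (3 * N ^ 2 - 1) + (3 * A ^ 2 - 1) * (p ^ 2 - x₁ ^ 2) +
      (3 * B ^ 2 - 1) * (q ^ 2 - x₂ ^ 2) := by
    -- Here 3N² - 1 = (1 - 3A²) + (1 - 3B²), and p, q ≤ l lets the l² terms absorb the negative
    -- ones.
    linear_combination h1 + h2 - 3 * l ^ 2 * hABN
  have h4 : 0 < 4 * (p * q) := by positivity
  exact hneg.not_ge (mul_nonneg h4.le h3)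

/-! ### Rotations and their normal form -/

noncomputable section

/-- The rotation about the `x`-axis through the angle with cosine `x` and sine `y`. -/
def rotX (x y : ℝ) (h : x ^ 2 + y ^ 2 = 1) : Matrix.specialOrthogonalGroup (Fin 3) ℝ :=
  ⟨!![1, 0, 0; 0, x, -y; 0, y, x], by
    rw [Matrix.mem_specialOrthogonalGroup_iff, Matrix.mem_orthogonalGroup_iff]
    constructor
    · ext i j
      fin_cases i <;> fin_cases j <;>
        simp [Matrix.mul_apply, Fin.sum_univ_three] <;> linarith
    · simp [Matrix.det_fin_three]; linarith⟩

/-- The rotation about the `y`-axis that takes the direction of the `x`-axis to `(x, 0, y)`. -/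
def rotY (x y : ℝ) (h : x ^ 2 + y ^ 2 = 1) : Matrix.specialOrthogonalGroup (Fin 3) ℝ :=
  ⟨!![x, 0, -y; 0, 1, 0; y, 0, x], by
    rw [Matrix.mem_specialOrthogonalGroup_iff, Matrix.mem_orthogonalGroup_iff]
    constructor
    · ext i j
      fin_cases i <;> fin_cases j <;>
        simp [Matrix.mul_apply, Fin.sum_univ_three] <;> linarith
    · simp [Matrix.det_fin_three]; linarith⟩

/-- The rotation about the `z`-axis through the angle with cosine `x` and sine `y`. -/
def rotZ (x y : ℝ) (h : x ^ 2 + y ^ 2 = 1) : Matrix.specialOrthogonalGroup (Fin 3) ℝ :=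
  ⟨!![x, -y, 0; y, x, 0; 0, 0, 1], by
    rw [Matrix.mem_specialOrthogonalGroup_iff, Matrix.mem_orthogonalGroup_iff]
    constructor
    · ext i j
      fin_cases i <;> fin_cases j <;>
        simp [Matrix.mul_apply, Fin.sum_univ_three] <;> linarith
    · simp [Matrix.det_fin_three]; linarith⟩

theorem continuous_matrix_fin_three {X : Type*} [TopologicalSpace X]
    {M : X → Matrix (Fin 3) (Fin 3) ℝ} (h : ∀ i j, Continuous fun x => M x i j) : Continuous M :=
  continuous_pi fun i => continuous_pi fun j => h i j

theorem continuous_rotX {X : Type*} [TopologicalSpace X] {f g : X → ℝ} (hf : Continuous f)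
    (hg : Continuous g) (h : ∀ x, f x ^ 2 + g x ^ 2 = 1) :
    Continuous fun x => rotX (f x) (g x) (h x) := by
  refine Continuous.subtype_mk (continuous_matrix_fin_three fun i j => ?_) _
  fin_cases i <;> fin_cases j <;> simp <;> fun_prop

theorem continuous_rotY {X : Type*} [TopologicalSpace X] {f g : X → ℝ} (hf : Continuous f)
    (hg : Continuous g) (h : ∀ x, f x ^ 2 + g x ^ 2 = 1) :
    Continuous fun x => rotY (f x) (g x) (h x) := by
  refine Continuous.subtype_mk (continuous_matrix_fin_three fun i j => ?_) _
  fin_cases i <;> fin_cases j <;> simp <;> fun_prop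

theorem continuous_rotZ {X : Type*} [TopologicalSpace X] {f g : X → ℝ} (hf : Continuous f)
    (hg : Continuous g) (h : ∀ x, f x ^ 2 + g x ^ 2 = 1) :
    Continuous fun x => rotZ (f x) (g x) (h x) := by
  refine Continuous.subtype_mk (continuous_matrix_fin_three fun i j => ?_) _
  fin_cases i <;> fin_cases j <;> simp <;> fun_prop

theorem row_orthonormal (R : Matrix.specialOrthogonalGroup (Fin 3) ℝ) (i j : Fin 3) :
    R.1 i 0 * R.1 j 0 + R.1 i 1 * R.1 j 1 + R.1 i 2 * R.1 j 2 = if i = j then 1 else 0 := by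
  have h := (Matrix.mem_orthogonalGroup_iff _ _).1 (Matrix.mem_specialOrthogonalGroup_iff.1 R.2).1
  have := congrFun (congrFun h i) j
  simpa [Matrix.mul_apply, Fin.sum_univ_three, Matrix.one_apply] using this

theorem col_orthonormal (R : Matrix.specialOrthogonalGroup (Fin 3) ℝ) (i j : Fin 3) :
    R.1 0 i * R.1 0 j + R.1 1 i * R.1 1 j + R.1 2 i * R.1 2 j = if i = j then 1 else 0 := by
  have h := (Matrix.mem_orthogonalGroup_iff' _ _).1 (Matrix.mem_specialOrthogonalGroup_iff.1 R.2).1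
  have := congrFun (congrFun h i) j
  simpa [Matrix.mul_apply, Fin.sum_univ_three, Matrix.one_apply] using this

/-- A rotation that fixes the direction of the `x`-axis is a rotation about this axis. -/
theorem exists_eq_rotX (K : Matrix.specialOrthogonalGroup (Fin 3) ℝ) (h0 : K.1 0 0 = 1)
    (h1 : K.1 1 0 = 0) (h2 : K.1 2 0 = 0) : ∃ C S, ∃ h : C ^ 2 + S ^ 2 = 1, K = rotX C S h := by
  have hr := row_orthonormal K 0 0
  have hc1 := col_orthonormal K 1 1
  have hc2 := col_orthonormal K 2 2
  have hdet := (Matrix.mem_specialOrthogonalGroup_iff.1 K.2).2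
  rw [Matrix.det_fin_three] at hdet
  simp only [h0, h1, h2, if_true] at hr hc1 hc2 hdet
  have h01 : K.1 0 1 = 0 := by nlinarith only [hr, sq_nonneg (K.1 0 1), sq_nonneg (K.1 0 2)]
  have h02 : K.1 0 2 = 0 := by nlinarith only [hr, sq_nonneg (K.1 0 1), sq_nonneg (K.1 0 2)]
  rw [h01] at hc1
  rw [h02] at hc2
  -- For a 2 × 2 block with unit columns and determinant 1, this sum of squares is 1 + 1 - 2.
  have hsum : (K.1 2 2 - K.1 1 1) ^ 2 + (K.1 1 2 + K.1 2 1) ^ 2 = 0 := by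
    linear_combination hc1 + hc2 - 2 * hdet
  have h22 : K.1 2 2 - K.1 1 1 = 0 := by
    nlinarith only [hsum, sq_nonneg (K.1 2 2 - K.1 1 1), sq_nonneg (K.1 1 2 + K.1 2 1)]
  have h12 : K.1 1 2 + K.1 2 1 = 0 := by
    nlinarith only [hsum, sq_nonneg (K.1 2 2 - K.1 1 1), sq_nonneg (K.1 1 2 + K.1 2 1)]
  refine ⟨K.1 1 1, K.1 2 1, by linarith, Subtype.ext ?_⟩
  ext i j
  fin_cases i <;> fin_cases j <;> simp [rotX, h0, h1, h2, h01, h02] <;> linarith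

/-- The rotation that takes `(p, q, 0)` to `u = (c e₀, c e₁, s)` and `(-q, p, 0)` to the unit vector
orthogonal to `u` with the coordinates `C`, `S` in the frame of `(-e₁, e₀, 0)` and
`(-s e₀, -s e₁, c)`. -/
def frame {e₀ e₁ c s C S p q : ℝ} (he : e₀ ^ 2 + e₁ ^ 2 = 1) (hcs : c ^ 2 + s ^ 2 = 1)
    (hCS : C ^ 2 + S ^ 2 = 1) (hpq : p ^ 2 + q ^ 2 = 1) :
    Matrix.specialOrthogonalGroup (Fin 3) ℝ :=
  rotZ e₀ e₁ he * rotY c s hcs * rotX C S hCS * rotZ p (-q) (by rwa [neg_sq])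

section

variable {e₀ e₁ c s C S p q : ℝ} (he : e₀ ^ 2 + e₁ ^ 2 = 1) (hcs : c ^ 2 + s ^ 2 = 1)
  (hCS : C ^ 2 + S ^ 2 = 1) (hpq : p ^ 2 + q ^ 2 = 1)

/-- The columns are the side directions p u - q w, q u + p w and the normal u × w. -/
theorem frame_val : (frame he hcs hCS hpq).1 =
    !![p * (c * e₀) - q * (-C * e₁ - S * s * e₀), q * (c * e₀) + p * (-C * e₁ - S * s * e₀),
        S * e₁ - C * s * e₀;
      p * (c * e₁) - q * (C * e₀ - S * s * e₁), q * (c * e₁) + p * (C * e₀ - S * s * e₁),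
        -S * e₀ - C * s * e₁;
      p * s - q * (S * c), q * s + p * (S * c), c * C] := by
  ext i j
  fin_cases i <;> fin_cases j <;>
    simp [frame, rotX, rotY, rotZ] <;> ring

/-- Every rotation that takes `(p, q, 0)` to `(c e₀, c e₁, s)` is of the form `frame`. -/
theorem exists_eq_frame (R : Matrix.specialOrthogonalGroup (Fin 3) ℝ)
    (h0 : R.1 0 0 * p + R.1 0 1 * q = c * e₀) (h1 : R.1 1 0 * p + R.1 1 1 * q = c * e₁)
    (h2 : R.1 2 0 * p + R.1 2 1 * q = s) :
    ∃ C S, ∃ hCS : C ^ 2 + S ^ 2 = 1, R = frame he hcs hCS hpq := by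
  have hpq' : p ^ 2 + (-q) ^ 2 = 1 := by rwa [neg_sq]
  have hy : c ^ 2 + (-s) ^ 2 = 1 := by rwa [neg_sq]
  have hz : e₀ ^ 2 + (-e₁) ^ 2 = 1 := by rwa [neg_sq]
  have invZ : rotZ p q hpq * rotZ p (-q) hpq' = 1 := by
    apply Subtype.ext
    ext i j
    fin_cases i <;> fin_cases j <;>
      simp [rotZ] <;> linarith
  have invZ' : rotZ e₀ e₁ he * rotZ e₀ (-e₁) hz = 1 := by
    apply Subtype.ext
    ext i j
    fin_cases i <;> fin_cases j <;>
      simp [rotZ] <;> linarith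
  have invY : rotY c s hcs * rotY c (-s) hy = 1 := by
    apply Subtype.ext
    ext i j
    fin_cases i <;> fin_cases j <;>
      simp [rotY] <;> linarith
  -- Undoing the turn, the pitch and the angle of the diagonal leaves a rotation fixing the `x`-axis
  -- pointwise.
  obtain ⟨C, S, hCS, hK⟩ := exists_eq_rotX
      (rotY c (-s) hy * rotZ e₀ (-e₁) hz * R * rotZ p q hpq) (by
    simp [rotY, rotZ, Matrix.mul_apply, Fin.sum_univ_three, Matrix.vecMul, dotProduct]
    linear_combination c * e₀ * h0 + c * e₁ * h1 + s * h2 + c ^ 2 * he + hcs) (by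
    simp [rotY, rotZ, Matrix.mul_apply, Fin.sum_univ_three, Matrix.vecMul, dotProduct]
    linear_combination -e₁ * h0 + e₀ * h1) (by
    simp [rotY, rotZ, Matrix.mul_apply, Fin.sum_univ_three, Matrix.vecMul, dotProduct]
    linear_combination -s * e₀ * h0 - s * e₁ * h1 + c * h2 - c * s * he)
  refine ⟨C, S, hCS, ?_⟩
  rw [frame, ← hK]
  calc R = (rotZ e₀ e₁ he * (rotY c s hcs * rotY c (-s) hy) * rotZ e₀ (-e₁) hz) * R *
        (rotZ p q hpq * rotZ p (-q) hpq') := by rw [invY, mul_one, invZ', invZ, one_mul, mul_one]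
    _ = _ := by simp only [mul_assoc]

end

/-! ### Odd and even parts of the ground -/

/-- Half the height difference of the ground at opposite points. -/
def oddPart (g : Plane → ℝ) (x y : ℝ) : ℝ := (g !₂[x, y] - g !₂[-x, -y]) / 2

/-- The mean height of the ground at opposite points. -/
def evenPart (g : Plane → ℝ) (x y : ℝ) : ℝ := (g !₂[x, y] + g !₂[-x, -y]) / 2

theorem evenPart_neg (g : Plane → ℝ) (x y : ℝ) : evenPart g (-x) (-y) = evenPart g x y := by
  simp only [evenPart, neg_neg, add_comm]

theorem two_mul_sq_ground_sub_le {g : Plane → ℝ} {k : NNReal} (hg : LipschitzWith k g)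
    (hk : (k : ℝ) ≤ 1 / Real.sqrt 2) (x y x' y' : ℝ) :
    2 * (g !₂[x, y] - g !₂[x', y']) ^ 2 ≤ (x - x') ^ 2 + (y - y') ^ 2 := by
  have h := hg.dist_le_mul !₂[x, y] !₂[x', y']
  rw [Real.dist_eq, EuclideanSpace.dist_eq] at h
  simp only [Fin.sum_univ_two, Real.dist_eq, sq_abs] at h
  have h1 := pow_le_pow_left₀ (abs_nonneg _) h 2
  rw [sq_abs, mul_pow, Real.sq_sqrt (by positivity)] at h1
  have h2 : (k : ℝ) ^ 2 ≤ 1 / 2 := by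
    have := pow_le_pow_left₀ k.coe_nonneg hk 2
    rwa [div_pow, Real.sq_sqrt (by norm_num), one_pow] at this
  simp at h1
  nlinarith only [h1, mul_le_mul_of_nonneg_right h2
    (add_nonneg (sq_nonneg (x - x')) (sq_nonneg (y - y')))]

theorem oddLipschitz_oddPart {g : Plane → ℝ} {k : NNReal} (hg : LipschitzWith k g)
    (hk : (k : ℝ) ≤ 1 / Real.sqrt 2) : OddLipschitz (oddPart g) where
  odd x y := by simp only [oddPart, neg_neg]; ring
  lip x y x' y' := by
    have h1 := two_mul_sq_ground_sub_le hg hk x y x' y'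
    have h2 := two_mul_sq_ground_sub_le hg hk (-x) (-y) (-x') (-y')
    simp only [oddPart]
    linear_combination h1 / 2 + h2 / 2 + 1 / 2 * sq_nonneg ((g !₂[x, y] - g !₂[x', y']) +
      (g !₂[-x, -y] - g !₂[-x', -y']))

theorem continuous_evenPart {g : Plane → ℝ} (hg : Continuous g) {X : Type*} [TopologicalSpace X]
    {f h : X → ℝ} (hf : Continuous f) (hh : Continuous h) :
    Continuous fun x => evenPart g (f x) (h x) := by
  have key : ∀ f h : X → ℝ, Continuous f → Continuous h →
      Continuous fun x => (!₂[f x, h x] : Plane) := by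
    intro f h hf hh
    refine (PiLp.continuous_toLp 2 _).comp (continuous_pi fun i => ?_)
    fin_cases i <;> simpa
  exact ((hg.comp (key f h hf hh)).add (hg.comp (key _ _ hf.neg hh.neg))).div_const 2

namespace Position

theorem move_apply (P : Position) (x : Space) (i : Fin 3) :
    P.move x i = P.1 i + (P.2.1 i 0 * x 0 + P.2.1 i 1 * x 1 + P.2.1 i 2 * x 2) := by
  simp [move, Matrix.mulVec, dotProduct, Fin.sum_univ_three]

/-- An equal hovering position in terms of the vectors from the centre to the feet `A` and `B`. -/
theorem equalHovering_iff (P : Position) (t : RealTable) (g : Plane → ℝ) :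
    P.EqualHovering t g ↔ (P.1 0 = 0 ∧ P.1 1 = 0) ∧ 0 ≤ P.2.1 2 2 ∧
      P.1 2 = evenPart g (P.2.1 0 0 * (t.side₁ / 2) + P.2.1 0 1 * (t.side₂ / 2))
        (P.2.1 1 0 * (t.side₁ / 2) + P.2.1 1 1 * (t.side₂ / 2)) ∧
      P.2.1 2 0 * (t.side₁ / 2) + P.2.1 2 1 * (t.side₂ / 2) =
        oddPart g (P.2.1 0 0 * (t.side₁ / 2) + P.2.1 0 1 * (t.side₂ / 2))
          (P.2.1 1 0 * (t.side₁ / 2) + P.2.1 1 1 * (t.side₂ / 2)) ∧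
      -(P.2.1 2 0 * (t.side₁ / 2)) + P.2.1 2 1 * (t.side₂ / 2) =
        oddPart g (-(P.2.1 0 0 * (t.side₁ / 2)) + P.2.1 0 1 * (t.side₂ / 2))
          (-(P.2.1 1 0 * (t.side₁ / 2)) + P.2.1 1 1 * (t.side₂ / 2)) := by
  unfold EqualHovering Centred Upright
  refine and_congr_right fun h => and_congr_right fun _ => ?_
  simp only [vertDist, move_apply, h.1, h.2, RealTable.footA, RealTable.footB, RealTable.footC,
    RealTable.footD, oddPart, evenPart]
  simp only [Matrix.cons_val_zero, Matrix.cons_val_one, Matrix.cons_val, mul_zero,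
    add_zero, zero_add, neg_div, mul_neg, neg_add, neg_neg]
  -- Sum and difference of the conditions at A and C give the even and the odd equation; at B and D
  -- only the difference is imposed.
  constructor
  · rintro ⟨h1, h2, h3⟩
    exact ⟨by linarith, by linarith, by linarith⟩
  · rintro ⟨h1, h2, h3⟩
    exact ⟨by linarith, by linarith, by linarith⟩

end Position

/-! ### Existence and continuity of pitch and roll -/

theorem sqrt_one_sub_sq_add_sq {x : ℝ} (hx : x ∈ Set.Icc (-1 : ℝ) 1) :
    √(1 - x ^ 2) ^ 2 + x ^ 2 = 1 := by
  rw [Real.sq_sqrt (by nlinarith [hx.1, hx.2])]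
  ring

theorem sqrt_one_sub_sq_eq {c x : ℝ} (hc : 0 ≤ c) (h : c ^ 2 + x ^ 2 = 1) : √(1 - x ^ 2) = c := by
  rw [← h, add_sub_cancel_right, Real.sqrt_sq hc]

theorem mem_Icc_of_sq_add_sq {c x : ℝ} (h : c ^ 2 + x ^ 2 = 1) : x ∈ Set.Icc (-1 : ℝ) 1 :=
  abs_le.1 (abs_le_one_iff_mul_self_le_one.2 (by nlinarith [sq_nonneg c]))

namespace OddLipschitz

variable {d : ℝ → ℝ → ℝ}

/-- On each meridian of the unit sphere there is exactly one point of the graph of `d`, and its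
height depends continuously on the meridian. -/
theorem exists_pitch (hd : OddLipschitz d) : ∃ σ : ℝ → ℝ, Continuous σ ∧
    ∀ γ s, (s ∈ Set.Icc (-1 : ℝ) 1 ∧
      s - d (√(1 - s ^ 2) * Real.cos γ) (√(1 - s ^ 2) * Real.sin γ) = 0) ↔ s = σ γ := by
  refine exists_continuous_unique_zero
    (fun γ s => s - d (√(1 - s ^ 2) * Real.cos γ) (√(1 - s ^ 2) * Real.sin γ)) ?_ ?_ ?_ ?_
  · exact continuous_snd.sub (hd.comp (by fun_prop) (by fun_prop))
  · intro γ
    simp [hd.zero]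
  · intro γ
    simp [hd.zero]
  · intro γ x hx y hy h h'
    exact hd.meridian_unique (Real.cos_sq_add_sin_sq γ) (Real.sqrt_nonneg _) (Real.sqrt_nonneg _)
      (sqrt_one_sub_sq_add_sq hx) (sqrt_one_sub_sq_add_sq hy) (sub_eq_zero.1 h) (sub_eq_zero.1 h')

/-- A pole would violate 2s² ≤ c². Strict positivity is what later turns an upright normal, c C ≥ 0,
into C ≥ 0. -/
theorem pitch_cos_pos (hd : OddLipschitz d) {c s γ : ℝ} (hc : 0 ≤ c) (h : c ^ 2 + s ^ 2 = 1)
    (hs : s = d (c * Real.cos γ) (c * Real.sin γ)) : 0 < c := by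
  have h1 := hd.sq_le hs
  have h2 : 2 * s ^ 2 ≤ c ^ 2 := by linear_combination h1 + c ^ 2 * Real.cos_sq_add_sin_sq γ
  refine lt_of_le_of_ne hc fun h0 => ?_
  rw [← h0] at h h2
  linarith

/-- For each position of the diagonal `AC` there is exactly one position of the diagonal `BD`, and
it depends continuously on the former. -/
theorem exists_roll (hd : OddLipschitz d) {c s : ℝ → ℝ} (hcc : Continuous c) (hsc : Continuous s)
    (hcs : ∀ γ, c γ ^ 2 + s γ ^ 2 = 1) (hc : ∀ γ, 0 < c γ)
    (hu : ∀ γ, s γ = d (c γ * Real.cos γ) (c γ * Real.sin γ)) {p q : ℝ} (hp : 0 < p) (hq : 0 < q)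
    (hpq : p ^ 2 + q ^ 2 = 1) : ∃ τ : ℝ → ℝ, Continuous τ ∧
    ∀ γ S, (S ∈ Set.Icc (-1 : ℝ) 1 ∧ (q ^ 2 - p ^ 2) * s γ + 2 * p * q * (S * c γ) -
      d ((q ^ 2 - p ^ 2) * (c γ * Real.cos γ) +
          2 * p * q * (-√(1 - S ^ 2) * Real.sin γ - S * s γ * Real.cos γ))
        ((q ^ 2 - p ^ 2) * (c γ * Real.sin γ) +
          2 * p * q * (√(1 - S ^ 2) * Real.cos γ - S * s γ * Real.sin γ)) = 0) ↔ S = τ γ := by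
  refine exists_continuous_unique_zero
    (fun γ S => (q ^ 2 - p ^ 2) * s γ + 2 * p * q * (S * c γ) -
      d ((q ^ 2 - p ^ 2) * (c γ * Real.cos γ) +
          2 * p * q * (-√(1 - S ^ 2) * Real.sin γ - S * s γ * Real.cos γ))
        ((q ^ 2 - p ^ 2) * (c γ * Real.sin γ) +
          2 * p * q * (√(1 - S ^ 2) * Real.cos γ - S * s γ * Real.sin γ))) ?_ ?_ ?_ ?_
  · exact Continuous.sub (by fun_prop) (hd.comp (by fun_prop) (by fun_prop))
  · intro γ
    -- At S = ∓1 the second diagonal lies in the vertical plane of the first, rotated down or up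
    -- from it.
    have h := hd.lt_of_rotate_down (Real.cos_sq_add_sin_sq γ) (hc γ) (hu γ) hp hq hpq
    have h0 : √(1 - (-1 : ℝ) ^ 2) = 0 := by norm_num
    simp only [h0, sub_nonpos]
    refine (le_of_eq ?_).trans (h.le.trans (le_of_eq ?_))
    · ring
    · congr 1 <;> ring
  · intro γ
    have h := hd.lt_of_rotate_up (Real.cos_sq_add_sin_sq γ) (hc γ) (hu γ) hp hq hpq
    have h0 : √(1 - (1 : ℝ) ^ 2) = 0 := by norm_num
    simp only [h0, sub_nonneg]
    refine (le_of_eq ?_).trans (h.le.trans (le_of_eq ?_))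
    · congr 1 <;> ring
    · ring
  · intro γ x hx y hy h h'
    exact hd.roll_unique (Real.cos_sq_add_sin_sq γ) (hcs γ) (hc γ) (sqrt_one_sub_sq_add_sq hx)
      (Real.sqrt_nonneg _) (sqrt_one_sub_sq_add_sq hy) (Real.sqrt_nonneg _) hp hq hpq (hu γ)
      (sub_eq_zero.1 h) (sub_eq_zero.1 h')

end OddLipschitz

/-! ### The turning argument -/

/-- A continuous function that takes only values of a continuous periodic function agrees with it
somewhere in each period. -/
theorem exists_eq_of_periodic {H E : ℝ → ℝ} (hH : Continuous H) (hE : Continuous E) {r : ℝ}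
    (hr : 0 < r) (hper : Function.Periodic H r) (hval : ∀ γ, ∃ γ', E γ = H γ') (γ₀ : ℝ) :
    ∃ γ ∈ Set.Icc γ₀ (γ₀ + r), H γ = E γ := by
  have hne : (Set.Icc γ₀ (γ₀ + r)).Nonempty := Set.nonempty_Icc.2 (by linarith)
  have hglob : ∀ γ, ∃ γ' ∈ Set.Icc γ₀ (γ₀ + r), E γ = H γ' := by
    intro γ
    obtain ⟨γ', h'⟩ := hval γ
    obtain ⟨y, hy, h⟩ := hper.exists_mem_Ico hr γ' γ₀
    exact ⟨y, Set.Ico_subset_Icc_self hy, h'.trans h⟩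
  obtain ⟨x, hx, hmin⟩ := isCompact_Icc.exists_isMinOn hne hH.continuousOn
  obtain ⟨y, hy, hmax⟩ := isCompact_Icc.exists_isMaxOn hne hH.continuousOn
  -- Every value of E is a value of H, so it lies between the minimum and the maximum of H.
  have h1 : H x - E x ≤ 0 := by
    obtain ⟨z, hz, h⟩ := hglob x
    rw [h, sub_nonpos]
    exact hmin hz
  have h2 : 0 ≤ H y - E y := by
    obtain ⟨z, hz, h⟩ := hglob y
    rw [h, sub_nonneg]
    exact hmax hz
  obtain ⟨γ, hγ, h⟩ := isPreconnected_Icc.intermediate_value hx hy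
    (hH.sub hE).continuousOn ⟨h1, h2⟩
  exact ⟨γ, hγ, sub_eq_zero.1 h⟩

theorem exists_polar (x y : ℝ) : ∃ γ : ℝ, x = √(x ^ 2 + y ^ 2) * Real.cos γ ∧
    y = √(x ^ 2 + y ^ 2) * Real.sin γ := by
  refine ⟨Complex.arg ⟨x, y⟩, ?_, ?_⟩
  · simpa [Complex.norm_def, Complex.normSq_apply, sq] using
      (Complex.norm_mul_cos_arg ⟨x, y⟩).symm
  · simpa [Complex.norm_def, Complex.normSq_apply, sq] using
      (Complex.norm_mul_sin_arg ⟨x, y⟩).symm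

/-- As the diagonal is 2, the bound 1/√(1 + r²) is exactly half the longer side. -/
theorem RealTable.half_side_le_leg (t : RealTable)
    (ht : 1 / Real.sqrt (1 + t.ratio ^ 2) ≤ t.leg) :
    t.side₁ / 2 ≤ t.leg ∧ t.side₂ / 2 ≤ t.leg := by
  have hM : 0 < max t.side₁ t.side₂ := lt_max_of_lt_left t.side₁_pos
  have hsq : min t.side₁ t.side₂ ^ 2 + max t.side₁ t.side₂ ^ 2 = 2 ^ 2 := by
    rcases le_total t.side₁ t.side₂ with h | h
    · rw [min_eq_left h, max_eq_right h, t.diagonal]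
    · rw [min_eq_right h, max_eq_left h, add_comm, t.diagonal]
  have hroot : 1 + t.ratio ^ 2 = (2 / max t.side₁ t.side₂) ^ 2 := by
    rw [ratio, div_pow, div_pow, ← hsq]
    field_simp
    ring
  rw [hroot, Real.sqrt_sq (by positivity), one_div_div] at ht
  exact ⟨by linarith [le_max_left t.side₁ t.side₂], by linarith [le_max_right t.side₁ t.side₂]⟩

/-! ### No point of the table is below the ground -/

/-- A point that lies steeply above a point on the ground is not below the ground. -/
theorem vertDist_nonneg_of_steep {g : Plane → ℝ} {k : NNReal} (hg : LipschitzWith k g)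
    (hk : (k : ℝ) ≤ 1 / Real.sqrt 2) {F X : Space} (hF : vertDist g F = 0) (h0 : 0 ≤ X 2 - F 2)
    (h : (X 0 - F 0) ^ 2 + (X 1 - F 1) ^ 2 ≤ 2 * (X 2 - F 2) ^ 2) : 0 ≤ vertDist g X := by
  have h1 := two_mul_sq_ground_sub_le hg hk (X 0) (X 1) (F 0) (F 1)
  have h2 := abs_le_of_sq_le_sq (by linarith :
    (g !₂[X 0, X 1] - g !₂[F 0, F 1]) ^ 2 ≤ (X 2 - F 2) ^ 2) h0
  unfold vertDist at *
  linarith [le_of_abs_le h2]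

namespace Position

/-- If the point `(x₁, x₂, z)` of the reference position is moved to a position steeply above that
of a foot on the ground, then it is not below the ground. -/
theorem vertDist_nonneg_of_foot {g : Plane → ℝ} {k : NNReal} (hg : LipschitzWith k g)
    (hk : (k : ℝ) ≤ 1 / Real.sqrt 2) (P : Position) {x F : Space} (hF0 : F 2 = 0)
    (hF : vertDist g (P.move F) = 0)
    (h0 : 0 ≤ (x 0 - F 0) * P.2.1 2 0 + (x 1 - F 1) * P.2.1 2 1 + x 2 * P.2.1 2 2)
    (h : (x 0 - F 0) ^ 2 + (x 1 - F 1) ^ 2 + x 2 ^ 2 ≤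
      3 * ((x 0 - F 0) * P.2.1 2 0 + (x 1 - F 1) * P.2.1 2 1 + x 2 * P.2.1 2 2) ^ 2) :
    0 ≤ vertDist g (P.move x) := by
  have c00 := col_orthonormal P.2 0 0
  have c11 := col_orthonormal P.2 1 1
  have c22 := col_orthonormal P.2 2 2
  have c01 := col_orthonormal P.2 0 1
  have c02 := col_orthonormal P.2 0 2
  have c12 := col_orthonormal P.2 1 2
  simp only [if_true, Fin.reduceEq, if_false] at c00 c11 c22 c01 c02 c12
  refine vertDist_nonneg_of_steep hg hk hF ?_ ?_
  · simp only [move_apply, hF0]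
    linarith
  · simp only [move_apply, hF0]
    -- A rotation preserves length, so 3z² ≥ |·|² in space becomes 2z² ≥ the squared horizontal
    -- length.
    linear_combination h + (x 0 - F 0) ^ 2 * c00 + (x 1 - F 1) ^ 2 * c11 + x 2 ^ 2 * c22 +
      2 * (x 0 - F 0) * (x 1 - F 1) * c01 + 2 * (x 0 - F 0) * x 2 * c02 +
      2 * (x 1 - F 1) * x 2 * c12

/-- An equal hovering position with all feet on the ground is balanced. -/
theorem EqualHovering.balancedLocally {g : Plane → ℝ} {k : NNReal} (hg : LipschitzWith k g)
    (hk : (k : ℝ) ≤ 1 / Real.sqrt 2) {t : RealTable}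
    (ht : 1 / Real.sqrt (1 + t.ratio ^ 2) ≤ t.leg) {P : Position} (hP : P.EqualHovering t g)
    (hB : vertDist g (P.move t.footB) = 0) : P.BalancedLocally t g := by
  have hd := oddLipschitz_oddPart hg hk
  obtain ⟨-, hN0, -, hu, hv⟩ := (equalHovering_iff P t g).1 hP
  obtain ⟨hcen, -, hA, hC, hBD⟩ := hP
  have hD : vertDist g (P.move t.footD) = 0 := hBD ▸ hB
  refine ⟨hcen, hA, hB, hC, hD, ?_⟩
  obtain ⟨p, hpdef⟩ : ∃ p, p = t.side₁ / 2 := ⟨_, rfl⟩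
  obtain ⟨q, hqdef⟩ : ∃ q, q = t.side₂ / 2 := ⟨_, rfl⟩
  obtain ⟨hpl, hql⟩ := t.half_side_le_leg ht
  have hp : 0 < p := by linarith [t.side₁_pos]
  have hq : 0 < q := by linarith [t.side₂_pos]
  have hpq : p ^ 2 + q ^ 2 = 1 := by rw [hpdef, hqdef]; linarith [t.diagonal]
  have hfeet : ∀ f₁ f₂ : ℝ, (f₁ = p ∨ f₁ = -p) → (f₂ = q ∨ f₂ = -q) →
      vertDist g (P.move !₂[f₁, f₂, 0]) = 0 := by
    rintro f₁ f₂ (rfl | rfl) (rfl | rfl) <;> rw [hpdef, hqdef] <;>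
      (try simp only [← neg_div]) <;> assumption
  simp only [← hpdef, ← hqdef] at hu hv hpl hql
  have c00 := col_orthonormal P.2 0 0
  have c11 := col_orthonormal P.2 1 1
  have c01 := col_orthonormal P.2 0 1
  have r22 := row_orthonormal P.2 2 2
  simp only [if_true, Fin.reduceEq, if_false] at c00 c11 c01 r22
  have hU := hd.sq_le hu
  have hV := hd.sq_le hv
  simp only [mul_comm _ p, mul_comm _ q, ← neg_mul p] at hu hv
  have hAflat := hd.side_flat hp hu hv
  simp only [neg_mul p] at hv
  have hBflat := hd.side_flat_right hq hu hv
  have hN : 1 ≤ 3 * P.2.1 2 2 ^ 2 := by linarith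
  have hNpos : 0 < P.2.1 2 2 := lt_of_le_of_ne hN0 fun h => by
    rw [← h] at hN
    norm_num at hN
  rintro x (⟨hx₁, hx₂, hx₃⟩ | ⟨hx₁, hx₂, hx₃, -⟩)
  · rw [← hpdef] at hx₁
    rw [← hqdef] at hx₂
    obtain ⟨f₁, f₂, h₁, h₂, h, h'⟩ := exists_foot_steeply_below (A := P.2.1 2 0) (B := P.2.1 2 1)
      (N := P.2.1 2 2) (by linarith) hNpos (by linarith) (by linarith) hp hq hpq hpl hql
      (by linear_combination hU + p ^ 2 * c00 + q ^ 2 * c11 + 2 * p * q * c01 + hpq)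
      (by linear_combination hV + p ^ 2 * c00 + q ^ 2 * c11 - 2 * p * q * c01 + hpq) hx₁ hx₂
    rw [← hx₃] at h h'
    exact vertDist_nonneg_of_foot hg hk P (F := !₂[f₁, f₂, 0]) rfl (hfeet f₁ f₂ h₁ h₂) h h'
  · rw [← hpdef] at hx₁
    rw [← hqdef] at hx₂
    -- A leg runs along the normal, which is itself steep since 3N² ≥ 1.
    refine vertDist_nonneg_of_foot hg hk P (F := !₂[x 0, x 1, 0]) rfl
      (hfeet _ _ (eq_or_eq_neg_of_abs_eq hx₁) (eq_or_eq_neg_of_abs_eq hx₂)) ?_ ?_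
    · simpa using mul_nonneg hx₃ hN0
    · simp
      nlinarith only [mul_le_mul_of_nonneg_left hN (sq_nonneg (x 2))]

end Position

end

/-! ### Assembly -/

theorem theorem2 (g : Plane → ℝ) (k : NNReal) (hg : LipschitzWith k g)
    (hk : (k : ℝ) ≤ 1 / Real.sqrt 2) (t : RealTable)
    (ht : 1 / Real.sqrt (1 + t.ratio ^ 2) ≤ t.leg) :
    CanBeBalancedByTurning t g := by
  have hd := oddLipschitz_oddPart hg hk
  obtain ⟨p, hpdef⟩ : ∃ p, p = t.side₁ / 2 := ⟨_, rfl⟩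
  obtain ⟨q, hqdef⟩ : ∃ q, q = t.side₂ / 2 := ⟨_, rfl⟩
  have hp : 0 < p := by linarith [t.side₁_pos]
  have hq : 0 < q := by linarith [t.side₂_pos]
  have hpq : p ^ 2 + q ^ 2 = 1 := by rw [hpdef, hqdef]; linarith [t.diagonal]
  obtain ⟨s, hsc, hs⟩ := hd.exists_pitch
  obtain ⟨c, hcdef⟩ : ∃ c : ℝ → ℝ, c = fun γ => √(1 - s γ ^ 2) := ⟨_, rfl⟩
  have hcc : Continuous c := by rw [hcdef]; fun_prop
  have hc0 : ∀ γ, 0 ≤ c γ := fun γ => by rw [hcdef]; exact Real.sqrt_nonneg _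
  have hcs : ∀ γ, c γ ^ 2 + s γ ^ 2 = 1 := fun γ => by
    rw [hcdef]; exact sqrt_one_sub_sq_add_sq ((hs γ _).2 rfl).1
  have hu : ∀ γ, s γ = oddPart g (c γ * Real.cos γ) (c γ * Real.sin γ) := fun γ => by
    rw [hcdef]; exact sub_eq_zero.1 ((hs γ _).2 rfl).2
  have hc : ∀ γ, 0 < c γ := fun γ => hd.pitch_cos_pos (hc0 γ) (hcs γ) (hu γ)
  have hs_unique : ∀ γ c' s', 0 ≤ c' → c' ^ 2 + s' ^ 2 = 1 →
      s' = oddPart g (c' * Real.cos γ) (c' * Real.sin γ) → s' = s γ ∧ c' = c γ := by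
    intro γ c' s' h0 h1 h2
    have h3 := sqrt_one_sub_sq_eq h0 h1
    have h4 : s' = s γ := (hs γ s').1 ⟨mem_Icc_of_sq_add_sq h1, by rw [h3, ← h2, sub_self]⟩
    exact ⟨h4, by rw [← h3, h4, hcdef]⟩
  obtain ⟨S, hSc, hS⟩ := hd.exists_roll hcc hsc hcs hc hu hp hq hpq
  obtain ⟨C, hCdef⟩ : ∃ C : ℝ → ℝ, C = fun γ => √(1 - S γ ^ 2) := ⟨_, rfl⟩
  have hCc : Continuous C := by rw [hCdef]; fun_prop
  have hC0 : ∀ γ, 0 ≤ C γ := fun γ => by rw [hCdef]; exact Real.sqrt_nonneg _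
  have hCS : ∀ γ, C γ ^ 2 + S γ ^ 2 = 1 := fun γ => by
    rw [hCdef]; exact sqrt_one_sub_sq_add_sq ((hS γ _).2 rfl).1
  -- `vx`, `vy`, `vz` are the coordinates of the vector from the centre to B.
  obtain ⟨vx, hvx⟩ : ∃ vx : ℝ → ℝ, vx = fun γ => (q ^ 2 - p ^ 2) * (c γ * Real.cos γ) +
    2 * p * q * (-C γ * Real.sin γ - S γ * s γ * Real.cos γ) := ⟨_, rfl⟩
  obtain ⟨vy, hvy⟩ : ∃ vy : ℝ → ℝ, vy = fun γ => (q ^ 2 - p ^ 2) * (c γ * Real.sin γ) +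
    2 * p * q * (C γ * Real.cos γ - S γ * s γ * Real.sin γ) := ⟨_, rfl⟩
  obtain ⟨vz, hvz⟩ : ∃ vz : ℝ → ℝ, vz = fun γ => (q ^ 2 - p ^ 2) * s γ +
    2 * p * q * (S γ * c γ) := ⟨_, rfl⟩
  have hv : ∀ γ, vz γ = oddPart g (vx γ) (vy γ) := fun γ => by
    rw [hvx, hvy, hvz, hCdef]; exact sub_eq_zero.1 ((hS γ _).2 rfl).2
  have hvnorm : ∀ γ, vx γ ^ 2 + vy γ ^ 2 + vz γ ^ 2 = 1 := fun γ => by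
    simp only [hvx, hvy, hvz]
    linear_combination ((q ^ 2 - p ^ 2) ^ 2 * c γ ^ 2 + 4 * p ^ 2 * q ^ 2 *
      (C γ ^ 2 + S γ ^ 2 * s γ ^ 2) - 4 * p * q * (q ^ 2 - p ^ 2) * c γ * S γ * s γ) *
      Real.cos_sq_add_sin_sq γ + ((q ^ 2 - p ^ 2) ^ 2 + 4 * p ^ 2 * q ^ 2 * S γ ^ 2) * hcs γ +
      4 * p ^ 2 * q ^ 2 * hCS γ + (p ^ 2 + q ^ 2 + 1) * hpq
  obtain ⟨H, hH⟩ : ∃ H : ℝ → ℝ, H = fun γ =>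
    evenPart g (c γ * Real.cos γ) (c γ * Real.sin γ) := ⟨_, rfl⟩
  have hHc : Continuous H := by
    rw [hH]; exact continuous_evenPart hg.continuous (by fun_prop) (by fun_prop)
  let R : ℝ → Matrix.specialOrthogonalGroup (Fin 3) ℝ := fun γ =>
    frame (Real.cos_sq_add_sin_sq γ) (hcs γ) (hCS γ) hpq
  have hRc : Continuous R :=
    (((continuous_rotZ Real.continuous_cos Real.continuous_sin Real.cos_sq_add_sin_sq).mul
      (continuous_rotY hcc hsc hcs)).mul (continuous_rotX hCc hSc hCS)).mul continuous_const
  let T : ℝ → Position := fun γ => (!₂[0, 0, H γ], R γ)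
  have hTc : Continuous T := by
    refine Continuous.prodMk ((PiLp.continuous_toLp 2 _).comp (continuous_pi fun i => ?_)) hRc
    fin_cases i
    · exact continuous_const
    · exact continuous_const
    · exact hHc
  have key : ∀ x y : ℝ, (p * x - q * y) * p + (q * x + p * y) * q = x ∧
      -((p * x - q * y) * p) + (q * x + p * y) * q = (q ^ 2 - p ^ 2) * x + 2 * p * q * y :=
    fun x y => ⟨by linear_combination x * hpq, by ring⟩
  have hT : ∀ γ, (T γ).EqualHovering t g := by
    intro γ
    rw [Position.equalHovering_iff, ← hpdef, ← hqdef]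
    simp only [T, R, frame_val]
    simp only [Matrix.of_apply, Matrix.cons_val, Matrix.cons_val_zero, Matrix.cons_val_one,
      (key _ _).1, (key _ _).2]
    refine ⟨⟨trivial, trivial⟩, mul_nonneg (hc0 γ) (hC0 γ), by rw [hH], hu γ, ?_⟩
    have := hv γ
    rwa [hvx, hvy, hvz] at this
  refine ⟨T, hTc, fun γ P => ⟨?_, ?_⟩, fun γ₀ => ?_⟩
  · rintro ⟨hP, ρ, hρ, hx, hy⟩
    rw [Position.equalHovering_iff, ← hpdef, ← hqdef] at hP
    obtain ⟨⟨h0, h1⟩, hup, hev, hPu, hPv⟩ := hP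
    simp only [Position.move_apply, RealTable.footA, ← hpdef, ← hqdef, add_sub_cancel_left,
      Matrix.cons_val, Matrix.cons_val_zero, Matrix.cons_val_one, mul_zero, add_zero] at hx hy
    have c00 := col_orthonormal P.2 0 0
    have c11 := col_orthonormal P.2 1 1
    have c01 := col_orthonormal P.2 0 1
    simp only [if_true, Fin.reduceEq, if_false] at c00 c11 c01
    have hnorm : ρ ^ 2 + (P.2.1 2 0 * p + P.2.1 2 1 * q) ^ 2 = 1 := by
      have h2 : (P.2.1 0 0 * p + P.2.1 0 1 * q) ^ 2 + (P.2.1 1 0 * p + P.2.1 1 1 * q) ^ 2 +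
          (P.2.1 2 0 * p + P.2.1 2 1 * q) ^ 2 = 1 := by
        linear_combination p ^ 2 * c00 + q ^ 2 * c11 + 2 * p * q * c01 + hpq
      rw [hx, hy] at h2
      linear_combination h2 - ρ ^ 2 * Real.cos_sq_add_sin_sq γ
    rw [hx, hy] at hPu hev
    -- Uniqueness on the meridian determines the diagonal AC; only the roll about it remains free.
    obtain ⟨hz, rfl⟩ := hs_unique γ ρ _ hρ.le hnorm hPu
    obtain ⟨C', S', hCS', hR⟩ := exists_eq_frame (Real.cos_sq_add_sin_sq γ) (hcs γ) hpq P.2 hx hy hz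
    simp only [hR, frame_val] at hup hPv
    simp only [Matrix.of_apply, Matrix.cons_val, Matrix.cons_val_zero, Matrix.cons_val_one,
      (key _ _).2] at hup hPv
    have hC' : 0 ≤ C' := nonneg_of_mul_nonneg_right hup (hc γ)
    have hroot := sqrt_one_sub_sq_eq hC' hCS'
    have hS' : S' = S γ := (hS γ S').1
      ⟨mem_Icc_of_sq_add_sq hCS', by rw [hroot, hPv, sub_self]⟩
    have hCC : C' = C γ := by rw [← hroot, hS', hCdef]
    subst hS' hCC
    refine Prod.ext ?_ hR
    ext i
    fin_cases i
    · exact h0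
    · exact h1
    · simpa [T, hH] using hev
  · rintro rfl
    refine ⟨hT γ, c γ, hc γ, ?_, ?_⟩
    · simp only [Position.move_apply, RealTable.footA, ← hpdef, ← hqdef, add_sub_cancel_left]
      simp only [T, R, frame_val, Matrix.of_apply, Matrix.cons_val, Matrix.cons_val_zero,
        Matrix.cons_val_one, mul_zero, add_zero, (key _ _).1]
    · simp only [Position.move_apply, RealTable.footA, ← hpdef, ← hqdef, add_sub_cancel_left]
      simp only [T, R, frame_val, Matrix.of_apply, Matrix.cons_val, Matrix.cons_val_zero,
        Matrix.cons_val_one, mul_zero, add_zero, (key _ _).1]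
  · obtain ⟨γ, hγ, hHE⟩ := exists_eq_of_periodic (E := fun γ => evenPart g (vx γ) (vy γ)) hHc
      (continuous_evenPart hg.continuous (by rw [hvx]; fun_prop) (by rw [hvy]; fun_prop))
      Real.pi_pos (by
        intro γ
        -- By oddness of d, the antipode of the point at γ is the point at γ + π.
        obtain ⟨-, h⟩ := hs_unique (γ + Real.pi) (c γ) (-s γ) (hc0 γ) (by rw [neg_sq, hcs])
          (by rw [Real.cos_add_pi, Real.sin_add_pi, mul_neg, mul_neg, hd.odd, ← hu])
        simp only [hH]
        rw [← h, Real.cos_add_pi, Real.sin_add_pi, mul_neg, mul_neg, evenPart_neg]) (by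
        intro γ
        -- At its own polar angle, the vector to B is the unique graph point on that meridian, so
        -- its mean ground height is H there.
        obtain ⟨γ', h1, h2⟩ := exists_polar (vx γ) (vy γ)
        obtain ⟨-, h⟩ := hs_unique γ' (√(vx γ ^ 2 + vy γ ^ 2)) (vz γ) (Real.sqrt_nonneg _)
          (by rw [Real.sq_sqrt (by positivity), hvnorm]) (by rw [← h1, ← h2, hv])
        refine ⟨γ', ?_⟩
        simp only [hH]
        rw [← h, ← h1, ← h2]) γ₀
    refine ⟨γ, hγ, (hT γ).balancedLocally hg hk ht ?_⟩
    have hvγ := hv γ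
    simp only [oddPart, evenPart] at hvγ hHE
    have hx : (T γ).move t.footB 0 = vx γ := by
      simp only [Position.move_apply, RealTable.footB, neg_div, ← hpdef, ← hqdef]
      simp only [T, R, frame_val, Matrix.of_apply, Matrix.cons_val, Matrix.cons_val_zero,
        Matrix.cons_val_one, mul_zero, add_zero, mul_neg, (key _ _).2, zero_add, hvx]
    have hy : (T γ).move t.footB 1 = vy γ := by
      simp only [Position.move_apply, RealTable.footB, neg_div, ← hpdef, ← hqdef]
      simp only [T, R, frame_val, Matrix.of_apply, Matrix.cons_val, Matrix.cons_val_zero,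
        Matrix.cons_val_one, mul_zero, add_zero, mul_neg, (key _ _).2, zero_add, hvy]
    have hz : (T γ).move t.footB 2 = H γ + vz γ := by
      simp only [Position.move_apply, RealTable.footB, neg_div, ← hpdef, ← hqdef]
      simp only [T, R, frame_val, Matrix.of_apply, Matrix.cons_val, Matrix.cons_val_zero,
        Matrix.cons_val_one, mul_zero, add_zero, mul_neg, (key _ _).2, hvz]
    rw [vertDist, hx, hy, hz]
    linarith
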